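/- Let $0\le p\le n$ be integers. A nonnegative pair $(\mathbf L;\mathbf V)$ consists of a symmetric matrix $\mathbf L\in\mathbb R^{n\times n}$ and a matrix $\mathbf V\in\mathbb R^{n\times p}$ of full column rank such that $\mathbf x^\top\mathbf L\mathbf x\ge 0$ for every $\mathbf x\in\mathbb R^n$ with $\mathbf V^\top\mathbf x=0$ (the case $p=0$ is allowed). For $X\subseteq\{1,\dots,n\}$ let $\mathbf A_X$ denote the principal submatrix of $\mathbf A$ with rows and columns in $X$, and $\mathbf V_{X,:}$ the submatrix of $\mathbf V$ with rows in $X$; the determinant of an empty matrix is $1$. An extended L-ensemble based on $(\mathbf L;\mathbf V)$ is a random subset $\mathcal X$ of $\{1,\dots,n\}$ such that, for all $X\subseteq\{1,\dots,n\}$, $$\mathbb P(\mathcal X=X)\ \propto\ (-1)^p\det\begin{pmatrix}\mathbf L_X&\mathbf V_{X,:}\\(\mathbf V_{X,:})^\top&\mathbf 0\end{pmatrix}.$$ A random subset $\mathcal X$ of $\{1,\dots,n\}$ is a determinantal point process (DPP) with marginal kernel $\mathbf K$, where $\mathbf K\in\mathbb R^{n\times n}$ is symmetric with $\mathbf 0\preceq\mathbf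 K\preceq\mathbf I$, if $\mathbb P(A\subseteq\mathcal X)=\det\mathbf K_A$ for all $A\subseteq\{1,\dots,n\}$. **Theorem.** Let $(\mathbf L;\mathbf V)$ be any nonnegative pair and let $\mathcal X$ be an extended L-ensemble based on $(\mathbf L;\mathbf V)$. Then $\mathcal X$ is a DPP. Moreover, for every $\mathbf Q\in\mathbb R^{n\times p}$ whose columns form an orthonormal basis of the column span of $\mathbf V$, with $\widetilde{\mathbf L}=(\mathbf I-\mathbf Q\mathbf Q^\top)\mathbf L(\mathbf I-\mathbf Q\mathbf Q^\top)$, the matrix $\mathbf I+\widetilde{\mathbf L}$ is invertible and $\mathcal X$ is a DPP with marginal kernel $$\mathbf K=\mathbf Q\mathbf Q^\top+\widetilde{\mathbf L}(\mathbf I+\widetilde{\mathbf L})^{-1}.$$ -/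

import Mathlib

open Matrix MeasureTheory

/-- `V` has full column rank, `L` is symmetric, and `L` is conditionally positive semi-definite with
respect to `V`, i.e. `xᵀ L x ≥ 0` whenever `Vᵀ x = 0`. The case `p = 0` is allowed, and `p ≤ n`
follows from the rank condition. -/
structure IsNonnegativePair {n p : ℕ} (L : Matrix (Fin n) (Fin n) ℝ)
    (V : Matrix (Fin n) (Fin p) ℝ) : Prop where
  symm : L.IsSymm
  condPosSemidef : ∀ x : Fin n → ℝ, Vᵀ *ᵥ x = 0 → 0 ≤ x ⬝ᵥ (L *ᵥ x)
  fullColumnRank : V.rank = p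

/-- The columns of `Q` form an orthonormal basis of the column span of `V`. -/
structure IsOrthonormalBasisOfSpan {n p : ℕ} (Q V : Matrix (Fin n) (Fin p) ℝ) : Prop where
  orthonormal : Qᵀ * Q = 1
  span_eq : Submodule.span ℝ (Set.range Q.col) = Submodule.span ℝ (Set.range V.col)

/-- The matrix `(I - Q Qᵀ) L (I - Q Qᵀ)`. -/
def Ltilde {n p : ℕ} (L : Matrix (Fin n) (Fin n) ℝ) (Q : Matrix (Fin n) (Fin p) ℝ) :
    Matrix (Fin n) (Fin n) ℝ :=
  (1 - Q * Qᵀ) * L * (1 - Q * Qᵀ)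

/-- The principal submatrix `A_X` with rows and columns in `X`. -/
def principalSubmatrix {n : ℕ} (A : Matrix (Fin n) (Fin n) ℝ) (X : Finset (Fin n)) :
    Matrix X X ℝ :=
  A.submatrix Subtype.val Subtype.val

/-- The submatrix `V_{X,:}` with rows in `X` and all the columns. -/
def rowSubmatrix {n p : ℕ} (V : Matrix (Fin n) (Fin p) ℝ) (X : Finset (Fin n)) :
    Matrix X (Fin p) ℝ :=
  V.submatrix Subtype.val id

/-- The saddle-point matrix with blocks `L_X`, `V_{X,:}`, `(V_{X,:})ᵀ` and `0`. -/
def saddleMatrix {n p : ℕ} (L : Matrix (Fin n) (Fin n) ℝ) (V : Matrix (Fin n) (Fin p) ℝ)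
    (X : Finset (Fin n)) : Matrix (X ⊕ Fin p) (X ⊕ Fin p) ℝ :=
  Matrix.fromBlocks (principalSubmatrix L X) (rowSubmatrix V X) (rowSubmatrix V X)ᵀ 0

/-- A finite point process on `{1, …, n}`: a random subset, i.e. a map to the finite set of subsets
that is measurable for the discrete σ-algebra. -/
def IsPointProcess {Ω : Type*} [MeasurableSpace Ω] {n : ℕ} (𝒳 : Ω → Finset (Fin n)) : Prop :=
  ∀ X : Finset (Fin n), MeasurableSet {ω | 𝒳 ω = X}

/-- `𝒳` is a point process under `P` with `P(𝒳 = X)` proportional to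
`(-1)^p det (saddleMatrix L V X)`. -/
def IsExtendedLEnsemble {Ω : Type*} [MeasurableSpace Ω] (P : Measure Ω) {n p : ℕ}
    (L : Matrix (Fin n) (Fin n) ℝ) (V : Matrix (Fin n) (Fin p) ℝ)
    (𝒳 : Ω → Finset (Fin n)) : Prop :=
  IsPointProcess 𝒳 ∧
    ∃ c : ℝ, ∀ X : Finset (Fin n),
      P.real {ω | 𝒳 ω = X} = c * ((-1) ^ p * (saddleMatrix L V X).det)

/-- `𝒳` is a determinantal point process under `P` with marginal kernel `K`, where `0 ⪯ K ⪯ I`. -/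
structure IsDPPWithMarginalKernel {Ω : Type*} [MeasurableSpace Ω] (P : Measure Ω) {n : ℕ}
    (K : Matrix (Fin n) (Fin n) ℝ) (𝒳 : Ω → Finset (Fin n)) : Prop where
  isPointProcess : IsPointProcess 𝒳
  posSemidef : K.PosSemidef
  le_one : (1 - K).PosSemidef
  inclusion : ∀ A : Finset (Fin n), P.real {ω | A ⊆ 𝒳 ω} = (principalSubmatrix K A).det

/-- `𝒳` is a determinantal point process under `P`. -/
def IsDPP {Ω : Type*} [MeasurableSpace Ω] (P : Measure Ω) {n : ℕ}
    (𝒳 : Ω → Finset (Fin n)) : Prop :=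
  ∃ K : Matrix (Fin n) (Fin n) ℝ, IsDPPWithMarginalKernel P K 𝒳

/-! Write `J = 1 + Ltilde L Q` and let `D` be the diagonal indicator of `A`. By multilinearity in
the rows, summing the saddle minors over `X ⊇ A` gives one saddle determinant, with `L + (1 - D)` in
the corner. A congruence that does not depend on `A` turns `(L, V)` into `(Ltilde L Q, Q)`, so the
corner becomes `J - D`. As `J` fixes `Q`, this determinant is its value at `A = ∅` times the minor
of the kernel on `A`. The leftover constant is 1 because `∅ ⊆ 𝒳` is certain. Conditional positivity
makes `J` positive definite, which also yields `0 ⪯ K ⪯ I`. -/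

section Determinants

variable {R m l : Type*} [CommRing R] [Fintype m] [DecidableEq m] [Fintype l] [DecidableEq l]

/-- The determinant of `M` with the rows of the first block outside `X` replaced by rows of the
identity is the minor of `M` obtained by deleting these rows and the corresponding columns. -/
theorem det_sumElim_piecewise_one (M : Matrix (m ⊕ l) (m ⊕ l) R) (X : Finset m) :
    det (Matrix.of (Sum.elim
      (X.piecewise (fun i => M (Sum.inl i)) fun i => (1 : Matrix (m ⊕ l) (m ⊕ l) R) (Sum.inl i))
      fun j => M (Sum.inr j))) =
    det (M.submatrix (Sum.map (Subtype.val : X → m) (id : l → l))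
      (Sum.map (Subtype.val : X → m) id)) := by
  let f : X ⊕ l → (X.disjSum (Finset.univ : Finset l)) := fun i =>
    ⟨Sum.map Subtype.val id i, by rcases i with i | i <;> simp⟩
  have hf : Function.Bijective f := by
    constructor
    · intro i j hij
      have h : Sum.map Subtype.val id i = Sum.map Subtype.val id j := congrArg Subtype.val hij
      exact Sum.map_injective.2 ⟨Subtype.val_injective, Function.injective_id⟩ h
    · rintro ⟨i | i, hi⟩
      · exact ⟨Sum.inl ⟨i, by simpa using hi⟩, rfl⟩
      · exact ⟨Sum.inr i, rfl⟩
  have h := det_piecewise_one_eq_submatrix_det M (X.disjSum (Finset.univ : Finset l))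
  rw [← Matrix.det_submatrix_equiv_self (Equiv.ofBijective f hf)] at h
  refine Eq.trans (congrArg det ?_) h
  ext i j
  rcases i with i | i
  · by_cases hi : i ∈ X <;> simp [Finset.piecewise, hi, Matrix.row]
  · simp [Finset.piecewise, Matrix.row]

/-- Adding to `M` the indicator of the complement of `A` in the diagonal of the first block sums
the minors of `M` over the sets of indices of the first block that contain `A`. -/
theorem det_add_diagonal_compl (M : Matrix (m ⊕ l) (m ⊕ l) R) (A : Finset m) :
    det (M + fromBlocks (diagonal fun i => if i ∈ A then 0 else 1) 0 0 0) =
      ∑ X with A ⊆ X, det (M.submatrix (Sum.map (Subtype.val : {i // i ∈ X} → m) (id : l → l))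
        (Sum.map (Subtype.val : {i // i ∈ X} → m) id)) := by
  let D : m → (m ⊕ l) → R := fun i =>
    if i ∈ A then 0 else (1 : Matrix (m ⊕ l) (m ⊕ l) R) (Sum.inl i)
  let g := (detRowAlternating (n := m ⊕ l) (R := R)).toMultilinearMap.currySum
  have hg : ∀ u : m → (m ⊕ l) → R, g u (fun j => M (Sum.inr j)) =
      det (Matrix.of (Sum.elim u fun j => M (Sum.inr j))) := fun u => rfl
  have h1 : det (M + fromBlocks (diagonal fun i => if i ∈ A then 0 else 1) 0 0 0) =
      g ((fun i => M (Sum.inl i)) + D) (fun j => M (Sum.inr j)) := by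
    rw [hg]
    congr 1
    ext i j
    rcases i with i | i
    · by_cases hi : i ∈ A
      · rcases j with j | j <;> simp [D, hi, diagonal_apply]
      · rcases j with j | j <;> simp [D, hi, diagonal_apply, one_apply]
    · rcases j with j | j <;> simp
  -- The term of `X` takes the rows of `M` on `X` and those of `D` off `X`; if `X` misses a point of
  -- `A`, a zero row kills it.
  rw [h1, MultilinearMap.map_add_univ, _root_.sum_apply, Finset.sum_filter]
  refine Finset.sum_congr rfl fun X _ => ?_
  rw [hg]
  split_ifs with hX
  · rw [← det_sumElim_piecewise_one]
    congr 3
    ext i : 1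
    by_cases hi : i ∈ X
    · simp [hi]
    · have hA : i ∉ A := fun h => hi (hX h)
      simp [hi, D, hA]
  · obtain ⟨i, hiA, hiX⟩ := Finset.not_subset.1 hX
    refine det_eq_zero_of_row_eq_zero (Sum.inl i) fun j => ?_
    simp [hiX, D, hiA]

/-- If `J * Q = Q`, `Qᵀ * J⁻¹ = Qᵀ` and `Q` has orthonormal columns, then removing the indicator
of `A` from the diagonal of `J` in the saddle-point matrix of `(J, Q)` multiplies the determinant
by the principal minor of `1 - J⁻¹ + Q * Qᵀ` with rows and columns in `A`. -/
theorem det_saddle_sub_diagonal (J : Matrix m m R) (Q : Matrix m l R) (hJ : IsUnit J.det)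
    (hQ : Qᵀ * Q = 1) (hJQ : J * Q = Q) (hQJ : Qᵀ * J = Qᵀ) (A : Finset m) :
    (fromBlocks (J - diagonal fun i => if i ∈ A then 1 else 0) Q Qᵀ 0).det =
      (fromBlocks J Q Qᵀ 0).det *
        ((1 - J⁻¹ + Q * Qᵀ).submatrix (Subtype.val : A → m) Subtype.val).det := by
  set D : Matrix m m R := diagonal fun i => if i ∈ A then 1 else 0 with hD
  -- `N` over `Qᵀ` is the first block column of the inverse of the saddle matrix of `(J, Q)`; this
  -- dictates the right factor in `hfac`.
  set N := J⁻¹ - Q * Qᵀ with hN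
  let E : Matrix m A R := (1 : Matrix m m R).submatrix id Subtype.val
  have hE : E * Eᵀ = D := by
    ext i j
    simp only [E, mul_apply, submatrix_apply, transpose_apply, one_apply, hD, diagonal_apply, id]
    simp only [ite_mul, one_mul, zero_mul]
    by_cases hi : i ∈ A
    · rw [Finset.sum_eq_single (⟨i, hi⟩ : A)]
      · simp [hi, eq_comm]
      · intro b _ hb
        exact if_neg fun h => hb (Subtype.ext h.symm)
      · simp
    · rw [Finset.sum_eq_zero]
      · simp [hi]
      · intro b _
        refine if_neg fun h => hi ?_
        rw [h]
        exact b.2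
  have hfac : fromBlocks (J - D) Q Qᵀ 0 =
      fromBlocks J Q Qᵀ 0 * fromBlocks (1 - N * D) 0 (-(Qᵀ * D)) (1 : Matrix l l R) := by
    have h1 : J * (1 - N * D) + Q * -(Qᵀ * D) = J - D := by
      have : J * N = 1 - Q * Qᵀ := by
        rw [hN, mul_sub, Matrix.mul_nonsing_inv _ hJ, ← Matrix.mul_assoc, hJQ]
      rw [mul_sub, ← Matrix.mul_assoc, this, Matrix.mul_neg, ← Matrix.mul_assoc]
      noncomm_ring
    have h2 : Qᵀ * (1 - N * D) = Qᵀ := by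
      have h3 : Qᵀ * J⁻¹ = Qᵀ := by
        conv_lhs => rw [← hQJ]
        rw [Matrix.mul_assoc, Matrix.mul_nonsing_inv _ hJ, Matrix.mul_one]
      have : Qᵀ * N = 0 := by
        rw [hN, Matrix.mul_sub, h3, ← Matrix.mul_assoc, hQ, Matrix.one_mul, sub_self]
      rw [Matrix.mul_sub, ← Matrix.mul_assoc, this, Matrix.zero_mul, Matrix.mul_one, sub_zero]
    rw [fromBlocks_multiply, h1, h2]
    simp
  have hNE : 1 - Eᵀ * (N * E) =
      (1 - J⁻¹ + Q * Qᵀ).submatrix (Subtype.val : A → m) Subtype.val := by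
    ext i j
    have : (Eᵀ * (N * E)) i j = N i j := by
      simp [E, mul_apply, one_apply]
    rw [Matrix.sub_apply, this, hN, submatrix_apply, Matrix.add_apply, Matrix.sub_apply,
      Matrix.sub_apply, one_apply, one_apply]
    simp only [Subtype.ext_iff]
    ring
  rw [hfac, det_mul, det_fromBlocks_zero₁₂, det_one, mul_one, ← hE, ← Matrix.mul_assoc,
    det_one_sub_mul_comm, hNE]

end Determinants

/-! ### Orthonormal bases of the column span. -/

section Orthonormal

variable {n p : ℕ} {L : Matrix (Fin n) (Fin n) ℝ} {Q V : Matrix (Fin n) (Fin p) ℝ}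

theorem IsOrthonormalBasisOfSpan.mul_transpose_mul (h : IsOrthonormalBasisOfSpan Q V) :
    Q * (Qᵀ * V) = V := by
  have hV : ∀ j, ∃ y, Q *ᵥ y = V.col j := by
    intro j
    have hj : V.col j ∈ Submodule.span ℝ (Set.range Q.col) := by
      rw [h.span_eq]
      exact Submodule.subset_span ⟨j, rfl⟩
    rw [← range_mulVecLin] at hj
    exact hj
  ext i j
  obtain ⟨y, hy⟩ := hV j
  have h1 : (Q * (Qᵀ * V)).col j = V.col j := by
    rw [← mulVec_single_one, ← mulVec_mulVec, ← mulVec_mulVec, mulVec_single_one, ← hy,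
      mulVec_mulVec y Qᵀ Q, h.orthonormal, one_mulVec]
  exact congrFun h1 i

-- Factor the Gram matrix as `Vᵀ * V = Bᵀ * B` with `B` square. Full column rank makes `B`
-- invertible, and `V * B⁻¹` works.
open scoped MatrixOrder in
theorem exists_isOrthonormalBasisOfSpan (hV : V.rank = p) :
    ∃ Q : Matrix (Fin n) (Fin p) ℝ, IsOrthonormalBasisOfSpan Q V := by
  obtain ⟨B, hB⟩ : ∃ B : Matrix (Fin p) (Fin p) ℝ, Vᵀ * V = Bᵀ * B := by
    have h := posSemidef_conjTranspose_mul_self V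
    obtain ⟨B, hB⟩ := CStarAlgebra.nonneg_iff_eq_star_mul_self.mp h.nonneg
    exact ⟨B, hB⟩
  have hdet : IsUnit B.det := by
    have h1 : (Vᵀ * V).rank = p := by rw [rank_transpose_mul_self, hV]
    have h2 : B.rank = p := by rw [← rank_transpose_mul_self, ← hB, h1]
    rw [← Matrix.isUnit_iff_isUnit_det]
    rw [← mulVec_surjective_iff_isUnit, ← coe_mulVecLin, ← LinearMap.range_eq_top]
    exact Submodule.eq_top_of_finrank_eq (by rw [← Matrix.rank, h2, Module.finrank_fin_fun])
  refine ⟨V * B⁻¹, ?_, ?_⟩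
  · rw [transpose_mul, Matrix.mul_assoc, ← Matrix.mul_assoc Vᵀ, hB, Matrix.mul_assoc,
      Matrix.mul_nonsing_inv _ hdet, Matrix.mul_one, ← transpose_mul,
      Matrix.mul_nonsing_inv _ hdet, transpose_one]
  · rw [← range_mulVecLin, ← range_mulVecLin]
    apply le_antisymm
    · rintro _ ⟨x, rfl⟩
      exact ⟨B⁻¹ *ᵥ x, by simp⟩
    · rintro _ ⟨x, rfl⟩
      exact ⟨B *ᵥ x, by simp [Matrix.nonsing_inv_mul _ hdet]⟩

end Orthonormal

/-! ### Positivity of `Ltilde` and the congruence of saddle matrices. -/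

section Kernel

variable {n p : ℕ} {L : Matrix (Fin n) (Fin n) ℝ} {Q V : Matrix (Fin n) (Fin p) ℝ}

theorem Ltilde_mul (hQ : Qᵀ * Q = 1) : Ltilde L Q * Q = 0 := by
  have h : (1 - Q * Qᵀ) * Q = 0 := by
    rw [Matrix.sub_mul, Matrix.mul_assoc, hQ, Matrix.one_mul, Matrix.mul_one, sub_self]
  rw [Ltilde, Matrix.mul_assoc, h, Matrix.mul_zero]

theorem transpose_mul_Ltilde (hQ : Qᵀ * Q = 1) : Qᵀ * Ltilde L Q = 0 := by
  have h : Qᵀ * (1 - Q * Qᵀ) = 0 := by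
    rw [Matrix.mul_sub, ← Matrix.mul_assoc, hQ, Matrix.one_mul, Matrix.mul_one, sub_self]
  rw [Ltilde, ← Matrix.mul_assoc, ← Matrix.mul_assoc, h, Matrix.zero_mul, Matrix.zero_mul]

/-- Since `Q * Qᵀ` fixes `V`, the projection `1 - Q * Qᵀ` maps into the kernel of `Vᵀ`, where `L` is
nonnegative. -/
theorem posSemidef_Ltilde (hLV : IsNonnegativePair L V) (hQ : IsOrthonormalBasisOfSpan Q V) :
    (Ltilde L Q).PosSemidef := by
  have hsymm : (1 - Q * Qᵀ)ᵀ = 1 - Q * Qᵀ := by simp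
  refine .of_dotProduct_mulVec_nonneg ?_ fun x => ?_
  · rw [IsHermitian, conjTranspose_eq_transpose_of_trivial, Ltilde, transpose_mul, transpose_mul,
      hsymm, hLV.symm.eq, Matrix.mul_assoc]
  · have h : Vᵀ *ᵥ ((1 - Q * Qᵀ) *ᵥ x) = 0 := by
      have h0 : Vᵀ * (1 - Q * Qᵀ) = 0 := by
        have := congrArg transpose hQ.mul_transpose_mul
        rw [transpose_mul, transpose_mul, transpose_transpose] at this
        rw [Matrix.mul_sub, ← Matrix.mul_assoc, this, Matrix.mul_one, sub_self]
      rw [mulVec_mulVec, h0, zero_mulVec]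
    have := hLV.condPosSemidef _ h
    rw [star_trivial, Ltilde, ← mulVec_mulVec, ← mulVec_mulVec, dotProduct_mulVec,
      ← mulVec_transpose, hsymm]
    exact this

theorem posDef_one_add_Ltilde (hLV : IsNonnegativePair L V) (hQ : IsOrthonormalBasisOfSpan Q V) :
    (1 + Ltilde L Q).PosDef :=
  PosDef.one.add_posSemidef (posSemidef_Ltilde hLV hQ)

theorem mul_one_add_inv_eq {M : Matrix (Fin n) (Fin n) ℝ} (hM : IsUnit (1 + M).det) :
    M * (1 + M)⁻¹ = 1 - (1 + M)⁻¹ := by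
  rw [eq_sub_iff_add_eq, ← add_one_mul, add_comm M, Matrix.mul_nonsing_inv _ hM]

theorem Matrix.PosSemidef.mul_one_add_inv {M : Matrix (Fin n) (Fin n) ℝ} (hM : M.PosSemidef) :
    (M * (1 + M)⁻¹).PosSemidef := by
  have hJ : (1 + M).PosDef := PosDef.one.add_posSemidef hM
  have hdet : IsUnit (1 + M).det := (isUnit_iff_isUnit_det _).1 hJ.isUnit
  have hinv : ((1 + M)⁻¹)ᴴ = (1 + M)⁻¹ := hJ.inv.isHermitian
  have h1 : (1 + M)⁻¹ * (M + M ^ 2) * ((1 + M)⁻¹)ᴴ = M * (1 + M)⁻¹ := by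
    have : M + M ^ 2 = (1 + M) * M := by noncomm_ring
    rw [hinv, this, ← Matrix.mul_assoc, Matrix.nonsing_inv_mul _ hdet, Matrix.one_mul]
  rw [← h1]
  exact (hM.add (hM.pow 2)).mul_mul_conjTranspose_same _

theorem saddle_congruence (hL : L.IsSymm) (hQ : IsOrthonormalBasisOfSpan Q V) :
    ∃ S : Matrix (Fin n ⊕ Fin p) (Fin n ⊕ Fin p) ℝ, ∀ D : Matrix (Fin n) (Fin n) ℝ,
      fromBlocks (L + D) V Vᵀ 0 = Sᵀ * fromBlocks (Ltilde L Q + D) Q Qᵀ 0 * S := by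
  -- `L - Ltilde L Q` contains `Q Qᵀ L Q Qᵀ` once, with a minus sign; the factor one half splits it
  -- evenly between `Q * Y` and its transpose.
  let Y : Matrix (Fin p) (Fin n) ℝ := Qᵀ * L - (2⁻¹ : ℝ) • (Qᵀ * L * Q * Qᵀ)
  have hV := hQ.mul_transpose_mul
  have hV' : Vᵀ * Q * Qᵀ = Vᵀ := by
    have := congrArg transpose hV
    rwa [transpose_mul, transpose_mul, transpose_transpose] at this
  have hY : Q * Y + Yᵀ * Qᵀ = L - Ltilde L Q := by
    have e1 : Q * Y = Q * Qᵀ * L - (2⁻¹ : ℝ) • (Q * Qᵀ * L * (Q * Qᵀ)) := by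
      simp only [Y, Matrix.mul_sub, Matrix.mul_smul, Matrix.mul_assoc]
    have e2 : Yᵀ * Qᵀ = L * (Q * Qᵀ) - (2⁻¹ : ℝ) • (Q * Qᵀ * L * (Q * Qᵀ)) := by
      simp only [Y, transpose_sub, transpose_smul, transpose_mul, transpose_transpose, hL.eq,
        Matrix.sub_mul, Matrix.smul_mul, Matrix.mul_assoc]
    have e4 : Ltilde L Q = L - Q * Qᵀ * L - L * (Q * Qᵀ) + Q * Qᵀ * L * (Q * Qᵀ) := by
      rw [Ltilde]; noncomm_ring
    rw [e1, e2, e4]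
    module
  refine ⟨fromBlocks 1 0 Y (Qᵀ * V), fun D => ?_⟩
  rw [fromBlocks_transpose, fromBlocks_multiply, fromBlocks_multiply]
  have h11 : L + D = Ltilde L Q + D + Yᵀ * Qᵀ + Q * Y := by
    rw [add_assoc _ (Yᵀ * Qᵀ), add_comm (Yᵀ * Qᵀ), hY]; abel
  simp [hV, hV', ← h11]

end Kernel

/-! ### Inclusion probabilities and the marginal kernel. -/

section PointProcess

variable {Ω : Type*} [MeasurableSpace Ω] {P : Measure Ω} [IsProbabilityMeasure P] {n p : ℕ}
  {L : Matrix (Fin n) (Fin n) ℝ} {Q V : Matrix (Fin n) (Fin p) ℝ} {𝒳 : Ω → Finset (Fin n)}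

theorem IsPointProcess.measureReal_subset (h : IsPointProcess 𝒳) (A : Finset (Fin n)) :
    P.real {ω | A ⊆ 𝒳 ω} = ∑ X with A ⊆ X, P.real {ω | 𝒳 ω = X} := by
  have : {ω | A ⊆ 𝒳 ω} = ⋃ X ∈ Finset.univ.filter (A ⊆ ·), {ω | 𝒳 ω = X} := by
    ext ω; simp
  rw [this, measureReal_biUnion_finset _ fun X _ => h X]
  intro X _ Y _ hXY
  exact Set.disjoint_left.2 fun ω hX hY => hXY (hX.symm.trans hY)

theorem IsExtendedLEnsemble.measureReal_subset (hLV : IsNonnegativePair L V)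
    (h : IsExtendedLEnsemble P L V 𝒳) (hQ : IsOrthonormalBasisOfSpan Q V) (A : Finset (Fin n)) :
    P.real {ω | A ⊆ 𝒳 ω} =
      (principalSubmatrix (Q * Qᵀ + Ltilde L Q * (1 + Ltilde L Q)⁻¹) A).det := by
  obtain ⟨hpp, c, hc⟩ := h
  have hdet : IsUnit (1 + Ltilde L Q).det :=
    (isUnit_iff_isUnit_det _).1 (posDef_one_add_Ltilde hLV hQ).isUnit
  obtain ⟨S, hS⟩ := saddle_congruence hLV.symm hQ
  have key : ∃ C : ℝ, ∀ A : Finset (Fin n), P.real {ω | A ⊆ 𝒳 ω} =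
      C * (principalSubmatrix (Q * Qᵀ + Ltilde L Q * (1 + Ltilde L Q)⁻¹) A).det := by
    refine ⟨c * (-1) ^ p * (S.det ^ 2 * (fromBlocks (1 + Ltilde L Q) Q Qᵀ 0).det), fun A => ?_⟩
    have h1 : ∑ X with A ⊆ X, (saddleMatrix L V X).det =
        (fromBlocks (L + diagonal fun i => if i ∈ A then 0 else 1) V Vᵀ 0).det := by
      have := det_add_diagonal_compl (fromBlocks L V Vᵀ 0) A
      rw [fromBlocks_add, add_zero, add_zero, add_zero] at this
      rw [this]
      refine Finset.sum_congr rfl fun X _ => congrArg det ?_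
      ext (i | i) (j | j) <;> rfl
    have h2 : Ltilde L Q + (diagonal fun i => if i ∈ A then (0 : ℝ) else 1) =
        1 + Ltilde L Q - diagonal fun i => if i ∈ A then (1 : ℝ) else 0 := by
      rw [add_comm 1, add_sub_assoc, ← diagonal_one, diagonal_sub]
      congr 2
      ext i
      split_ifs <;> simp
    have h3 : Q * Qᵀ + Ltilde L Q * (1 + Ltilde L Q)⁻¹ =
        1 - (1 + Ltilde L Q)⁻¹ + Q * Qᵀ := by
      rw [mul_one_add_inv_eq hdet, add_comm]
    rw [hpp.measureReal_subset]
    simp_rw [hc]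
    rw [← Finset.mul_sum, ← Finset.mul_sum, h1, hS, det_mul, det_mul, det_transpose, h2,
      det_saddle_sub_diagonal _ Q hdet hQ.orthonormal
        (by rw [Matrix.add_mul, Ltilde_mul hQ.orthonormal, Matrix.one_mul, add_zero])
        (by rw [Matrix.mul_add, transpose_mul_Ltilde hQ.orthonormal, Matrix.mul_one, add_zero]),
      ← h3, principalSubmatrix]
    ring
  obtain ⟨C, hC⟩ := key
  have h0 := hC ∅
  simp only [Finset.empty_subset, Set.ofPred_true, probReal_univ, det_isEmpty, mul_one] at h0
  rw [hC, ← h0, one_mul]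

theorem IsExtendedLEnsemble.isDPPWithMarginalKernel (hLV : IsNonnegativePair L V)
    (h : IsExtendedLEnsemble P L V 𝒳) (hQ : IsOrthonormalBasisOfSpan Q V) :
    IsDPPWithMarginalKernel P (Q * Qᵀ + Ltilde L Q * (1 + Ltilde L Q)⁻¹) 𝒳 := by
  have hJ := posDef_one_add_Ltilde hLV hQ
  have hdet : IsUnit (1 + Ltilde L Q).det := (isUnit_iff_isUnit_det _).1 hJ.isUnit
  refine ⟨h.1, ?_, ?_, h.measureReal_subset hLV hQ⟩
  · exact (posSemidef_self_mul_conjTranspose Q).add (posSemidef_Ltilde hLV hQ).mul_one_add_inv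
  · have hJQ : (1 + Ltilde L Q)⁻¹ * Q = Q := by
      have : (1 + Ltilde L Q) * Q = Q := by
        rw [Matrix.add_mul, Ltilde_mul hQ.orthonormal, Matrix.one_mul, add_zero]
      have := congrArg ((1 + Ltilde L Q)⁻¹ * ·) this
      rwa [← Matrix.mul_assoc, Matrix.nonsing_inv_mul _ hdet, Matrix.one_mul, eq_comm] at this
    have hQJ : Qᵀ * (1 + Ltilde L Q)⁻¹ = Qᵀ := by
      have : Qᵀ * (1 + Ltilde L Q) = Qᵀ := by
        rw [Matrix.mul_add, transpose_mul_Ltilde hQ.orthonormal, Matrix.mul_one, add_zero]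
      have := congrArg (· * (1 + Ltilde L Q)⁻¹) this
      rwa [Matrix.mul_assoc, Matrix.mul_nonsing_inv _ hdet, Matrix.mul_one, eq_comm] at this
    -- The left side is `(1 + Ltilde L Q)⁻¹ - Q * Qᵀ`, the compression of this inverse to the
    -- orthogonal complement of the span of `Q`.
    have h1 : 1 - (Q * Qᵀ + Ltilde L Q * (1 + Ltilde L Q)⁻¹) =
        (1 - Q * Qᵀ) * (1 + Ltilde L Q)⁻¹ * (1 - Q * Qᵀ)ᴴ := by
      have hs : (1 - Q * Qᵀ)ᴴ = 1 - Q * Qᵀ := by simp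
      have e1 : (1 - Q * Qᵀ) * (1 + Ltilde L Q)⁻¹ = (1 + Ltilde L Q)⁻¹ - Q * Qᵀ := by
        rw [Matrix.sub_mul, Matrix.mul_assoc, hQJ, Matrix.one_mul]
      have e2 : Q * Qᵀ * (Q * Qᵀ) = Q * Qᵀ := by
        rw [Matrix.mul_assoc, ← Matrix.mul_assoc Qᵀ, hQ.orthonormal, Matrix.one_mul]
      rw [hs, e1, Matrix.mul_sub, Matrix.mul_one, Matrix.sub_mul, e2, ← Matrix.mul_assoc, hJQ,
        mul_one_add_inv_eq hdet]
      abel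
    rw [h1]
    exact hJ.inv.posSemidef.mul_mul_conjTranspose_same _

end PointProcess

theorem mainTheorem2 {Ω : Type*} [MeasurableSpace Ω] (P : Measure Ω) [IsProbabilityMeasure P]
    {n p : ℕ} (L : Matrix (Fin n) (Fin n) ℝ) (V : Matrix (Fin n) (Fin p) ℝ)
    (hLV : IsNonnegativePair L V) (𝒳 : Ω → Finset (Fin n))
    (h𝒳 : IsExtendedLEnsemble P L V 𝒳) :
    IsDPP P 𝒳 ∧
      ∀ Q : Matrix (Fin n) (Fin p) ℝ, IsOrthonormalBasisOfSpan Q V →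
        IsUnit (1 + Ltilde L Q) ∧
          IsDPPWithMarginalKernel P (Q * Qᵀ + Ltilde L Q * (1 + Ltilde L Q)⁻¹) 𝒳 := by
  refine ⟨?_, fun Q hQ => ⟨(posDef_one_add_Ltilde hLV hQ).isUnit,
    h𝒳.isDPPWithMarginalKernel hLV hQ⟩⟩
  obtain ⟨Q, hQ⟩ := exists_isOrthonormalBasisOfSpan hLV.fullColumnRank
  exact ⟨_, h𝒳.isDPPWithMarginalKernel hLV hQ⟩
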